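/- A right-preordered group is a group $(X,+,0)$ (written additively, not necessarily abelian) with a preorder $\le$ such that $x\le y$ implies $x+z\le y+z$ for all $x,y,z\in X$; its positive cone is the submonoid $P_X=\{x\in X : 0\le x\}$. Let $\mathbf{ROrdGrp}$ be the category of right-preordered groups and monotone group homomorphisms; it is pointed and finitely complete. Two morphisms $f\colon X\to B$, $g\colon Z\to B$ of a category are jointly strongly epimorphic if they are jointly epimorphic and, for every monomorphism $m\colon M\to N$ and all $v\colon B\to N$, $a\colon X\to M$, $b\colon Z\to M$ with $ma=vf$ and $mb=vg$, there is $d\colon B\to M$ with $md=v$, $df=a$ and $dg=b$. In a pointed finitely complete category, a point over $B$ is a pair $(f\colon A\to B,\ s\colon B\to A)$ with $fs=1_B$. It is strong if $\ker f$ and $s$ are jointly strongly epimorphic, and stably strong if for every morphism $g\colon D\to B$ the pullback point $(A\times_B D\to D,\ \langle sg,1_D\rangle)$ is strong. An object $Y$ is - a protomodular object if every point over $Y$ is stably strong; - a Mal'tsev object if for all points $(f\colon A\to Y,s)$ and $(g\colon D\to Y,t)$ over $Y$ the morphisms $\langle 1_A,tf\rangle\colon A\to A\times_Y D$ and $\langle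 sg,1_D\rangle\colon D\to A\times_Y D$ are jointly strongly epimorphic; - a strongly unital object if the point $(\pi_2\colon Y\times Y\to Y,\ \langle 1_Y,1_Y\rangle)$ is stably strong. Theorem. For a right-preordered group $Y$, the following conditions are equivalent: 1. $Y$ is a protomodular object in $\mathbf{ROrdGrp}$; 2. $Y$ is a Mal'tsev object in $\mathbf{ROrdGrp}$; 3. $Y$ is a strongly unital object in $\mathbf{ROrdGrp}$; 4. the positive cone $P_Y$ is a group, i.e. every element of the monoid $P_Y$ has an inverse in $P_Y$; 5. the preorder relation $\le$ on $Y$ is an equivalence relation. -/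

import Mathlib

open CategoryTheory CategoryTheory.Limits

universe v u

namespace CategoryTheory

section Points

variable {C : Type u} [Category.{v} C]

/-- Two morphisms `f : X ⟶ B` and `g : Y ⟶ B` are jointly strongly epimorphic: they are jointly
epimorphic, and the pair is left orthogonal to every monomorphism. -/
structure JointlyStrongEpi {X Y B : C} (f : X ⟶ B) (g : Y ⟶ B) : Prop where
  jointlyEpi : ∀ ⦃Z : C⦄ (a b : B ⟶ Z), f ≫ a = f ≫ b → g ≫ a = g ≫ b → a = b
  exists_lift : ∀ ⦃M N : C⦄ (m : M ⟶ N) [Mono m] (v : B ⟶ N) (a : X ⟶ M) (b : Y ⟶ M),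
    a ≫ m = f ≫ v → b ≫ m = g ≫ v → ∃ d : B ⟶ M, d ≫ m = v ∧ f ≫ d = a ∧ g ≫ d = b

/-- A point over `B` with domain `A`: a split epimorphism together with a fixed section. -/
structure Point (A B : C) where
  /-- the split epimorphism -/
  π : A ⟶ B
  /-- the section -/
  σ : B ⟶ A
  σ_π : σ ≫ π = 𝟙 B

namespace Point

/-- The point `(π₂, ⟨1, 1⟩)` over `Y` with domain `Y × Y`. -/
noncomputable def sndDiag [HasFiniteLimits C] (Y : C) : Point (Y ⨯ Y) Y where
  π := prod.snd
  σ := diag Y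
  σ_π := prod.lift_snd _ _

/-- The pullback of a point over `B` along a morphism `g : D ⟶ B`, with the induced section
`⟨g ≫ σ, 1⟩`. -/
noncomputable def baseChange [HasFiniteLimits C] {A B : C} (p : Point A B) {D : C} (g : D ⟶ B) :
    Point (pullback p.π g) D where
  π := pullback.snd p.π g
  σ := pullback.lift (g ≫ p.σ) (𝟙 D) (by rw [Category.assoc, p.σ_π, Category.comp_id,
    Category.id_comp])
  σ_π := pullback.lift_snd _ _ _

variable [HasZeroMorphisms C] [HasFiniteLimits C]

/-- A point is strong if the kernel of the split epimorphism and the section are jointly strongly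
epimorphic. -/
def IsStrong {A B : C} (p : Point A B) : Prop :=
  JointlyStrongEpi (kernel.ι p.π) p.σ

/-- A point is stably strong if all its pullbacks are strong. -/
def IsStablyStrong {A B : C} (p : Point A B) : Prop :=
  ∀ ⦃D : C⦄ (g : D ⟶ B), (p.baseChange g).IsStrong

end Point

/-- `Y` is a strongly unital object: the point `(π₂, ⟨1, 1⟩) : Y × Y ⇄ Y` is stably strong. -/
def IsStronglyUnitalObject [HasZeroMorphisms C] [HasFiniteLimits C] (Y : C) : Prop :=
  (Point.sndDiag Y).IsStablyStrong

/-- `Y` is a Mal'tsev object: for all points `(f, s) : A ⇄ Y` and `(g, t) : D ⇄ Y`, the morphisms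
`⟨1, t f⟩ : A ⟶ A ×_Y D` and `⟨s g, 1⟩ : D ⟶ A ×_Y D` are jointly strongly epimorphic. -/
def IsMaltsevObject [HasFiniteLimits C] (Y : C) : Prop :=
  ∀ ⦃A D : C⦄ (p : Point A Y) (q : Point D Y),
    JointlyStrongEpi
      (pullback.lift (f := p.π) (g := q.π) (𝟙 A) (p.π ≫ q.σ) (by
        rw [Category.assoc, q.σ_π, Category.comp_id, Category.id_comp]))
      (pullback.lift (f := p.π) (g := q.π) (q.π ≫ p.σ) (𝟙 D) (by
        rw [Category.assoc, p.σ_π, Category.comp_id, Category.id_comp]))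

/-- `Y` is a protomodular object: every point over `Y` is stably strong. -/
def IsProtomodularObject [HasZeroMorphisms C] [HasFiniteLimits C] (Y : C) : Prop :=
  ∀ ⦃A : C⦄ (p : Point A Y), p.IsStablyStrong

end Points

end CategoryTheory

/-- Right-preordered groups (written additively, not assumed commutative): groups with a preorder
such that `x ≤ y` implies `x + z ≤ y + z`. -/
structure ROrdGrp where
  of ::
  /-- the underlying type -/
  carrier : Type u
  [addGroup : AddGroup carrier]
  [preorder : Preorder carrier]
  [addRightMono : AddRightMono carrier]

namespace ROrdGrp

attribute [instance] addGroup preorder addRightMono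

instance : CoeSort ROrdGrp.{u} (Type u) := ⟨ROrdGrp.carrier⟩

attribute [coe] ROrdGrp.carrier

/-- Morphisms of right-preordered groups: monotone group homomorphisms. -/
@[ext]
structure Hom (X Y : ROrdGrp.{u}) where
  hom' : X →+o Y

instance : Category ROrdGrp.{u} where
  Hom X Y := Hom X Y
  id X := ⟨OrderAddMonoidHom.id X⟩
  comp f g := ⟨g.hom'.comp f.hom'⟩

instance : ConcreteCategory ROrdGrp.{u} (fun X Y => X →+o Y) where
  hom := Hom.hom'
  ofHom := Hom.mk

/-- A monotone group homomorphism as a morphism of `ROrdGrp`. -/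
abbrev ofHom {X Y : ROrdGrp.{u}} (f : X →+o Y) : X ⟶ Y :=
  ConcreteCategory.ofHom (C := ROrdGrp) f

@[ext]
lemma hom_ext {X Y : ROrdGrp.{u}} {f g : X ⟶ Y} (w : ∀ x : X, f x = g x) : f = g :=
  ConcreteCategory.hom_ext _ _ w

/-- The positive cone `P_X = {x | 0 ≤ x}`, a submonoid of `X`. -/
def positiveCone (X : ROrdGrp.{u}) : AddSubmonoid X where
  carrier := {x | 0 ≤ x}
  zero_mem' := le_refl (0 : X)
  add_mem' {x y} hx hy := by
    have h : (0 : X) + y ≤ x + y := add_le_add_left hx y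
    rw [zero_add] at h
    exact le_trans hy h

instance : HasZeroMorphisms ROrdGrp.{u} where
  zero X Y := ⟨ofHom 0⟩
  comp_zero _ _ := rfl
  zero_comp X Y Z f := by
    ext x
    exact map_zero (ConcreteCategory.hom f)

/-- The pullback of `f : X ⟶ Z` and `g : Y ⟶ Z`: the subgroup `{(x, y) | f x = g y}` of `X × Y`
with the componentwise preorder. -/
def pullbackObj {X Y Z : ROrdGrp.{u}} (f : X ⟶ Z) (g : Y ⟶ Z) : ROrdGrp.{u} :=
  letI S : AddSubgroup (X × Y) :=
    { carrier := {p | f p.1 = g p.2}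
      zero_mem' := by
        change f 0 = g 0
        rw [map_zero, map_zero]
      add_mem' := fun {p q} (hp : f p.1 = g p.2) (hq : f q.1 = g q.2) => by
        change f (p.1 + q.1) = g (p.2 + q.2)
        rw [map_add, map_add, hp, hq]
      neg_mem' := fun {p} (hp : f p.1 = g p.2) => by
        change f (-p.1) = g (-p.2)
        rw [map_neg, map_neg, hp] }
  haveI : AddRightMono S := ⟨fun r _ _ h =>
    ⟨add_le_add_left (α := X) h.1 r.1.1, add_le_add_left (α := Y) h.2 r.1.2⟩⟩
  of S

/-- The pullback cone on `pullbackObj f g` given by the two projections. -/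
def pullbackCone {X Y Z : ROrdGrp.{u}} (f : X ⟶ Z) (g : Y ⟶ Z) : PullbackCone f g :=
  PullbackCone.mk (W := pullbackObj f g)
    (ofHom
      { toFun := fun p => p.1.1
        map_zero' := rfl
        map_add' := fun _ _ => rfl
        monotone' := fun _ _ h => h.1 })
    (ofHom
      { toFun := fun p => p.1.2
        map_zero' := rfl
        map_add' := fun _ _ => rfl
        monotone' := fun _ _ h => h.2 })
    (hom_ext fun p => p.2)

/-- `pullbackCone f g` is a limit cone. -/
def pullbackConeIsLimit {X Y Z : ROrdGrp.{u}} (f : X ⟶ Z) (g : Y ⟶ Z) :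
    IsLimit (pullbackCone f g) :=
  PullbackCone.IsLimit.mk _
    (fun s => ofHom
      { toFun := fun w => ⟨(s.fst w, s.snd w), ConcreteCategory.congr_hom s.condition w⟩
        map_zero' := Subtype.ext (Prod.ext (map_zero (ConcreteCategory.hom s.fst))
          (map_zero (ConcreteCategory.hom s.snd)))
        map_add' := fun a b => Subtype.ext (Prod.ext (map_add (ConcreteCategory.hom s.fst) a b)
          (map_add (ConcreteCategory.hom s.snd) a b))
        monotone' := fun _ _ h => ⟨(ConcreteCategory.hom s.fst).monotone' h,
          (ConcreteCategory.hom s.snd).monotone' h⟩ })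
    (fun _ => rfl)
    (fun _ => rfl)
    (fun _ _ h₁ h₂ => hom_ext fun w => Subtype.ext (Prod.ext (ConcreteCategory.congr_hom h₁ w)
      (ConcreteCategory.congr_hom h₂ w)))

instance : HasPullbacks ROrdGrp.{u} :=
  haveI : ∀ {X Y Z : ROrdGrp.{u}} {f : X ⟶ Z} {g : Y ⟶ Z}, HasLimit (cospan f g) :=
    fun {_ _ _ f g} => ⟨⟨⟨pullbackCone f g, pullbackConeIsLimit f g⟩⟩⟩
  hasPullbacks_of_hasLimit_cospan _

instance : HasTerminal ROrdGrp.{u} :=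
  haveI : AddRightMono PUnit.{u + 1} := ⟨fun _ _ _ _ => le_refl _⟩
  IsTerminal.hasTerminal (X := of PUnit.{u + 1})
    (IsTerminal.ofUniqueHom (fun _ => 0) (fun _ _ => hom_ext fun _ => rfl))

instance : HasFiniteLimits ROrdGrp.{u} :=
  hasFiniteLimits_of_hasTerminal_and_pullbacks

end ROrdGrp

/-! In every pointed category with finite limits, protomodular objects are Mal'tsev and Mal'tsev
objects are strongly unital. In `ROrdGrp` two morphisms are jointly strongly epimorphic iff their
images generate the codomain as a group and the images of the positive cones generate its positive
cone as a monoid. Let `Y` be strongly unital and `0 ≤ y`. Then `(0, y)` is a sum of elements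
`(a, 0)` and `(b, b)` with `a` and `b` in `P_Y`. In a sum of this kind, if the first entry is
invertible in `P_Y`, then so is the second, because a sum is invertible in `P_Y` only if its
summands are. As `0` is invertible, so is `y`. Conversely, if `P_B` is a group and `(f, s)` is a
point over `B`, then `0 ≤ a` implies `0 ≤ a - s f a`. Hence `a = (a - s f a) + s f a` splits a
positive element into a positive element of the kernel and the image of a positive element of `B`,
and the condition on `a - s f a` passes to pullbacks of the point. -/

section Categorical

attribute [local simp] prod.lift_fst prod.lift_snd pullback.lift_fst pullback.lift_snd
  prod.lift_fst_assoc prod.lift_snd_assoc pullback.lift_fst_assoc pullback.lift_snd_assoc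

variable {C : Type u} [Category.{v} C]

lemma jointlyStrongEpi_iff_isIso [HasFiniteLimits C] {X Z B : C} {f : X ⟶ B} {g : Z ⟶ B} :
    JointlyStrongEpi f g ↔ ∀ ⦃M : C⦄ (m : M ⟶ B) [Mono m] (a : X ⟶ M) (b : Z ⟶ M),
      a ≫ m = f → b ≫ m = g → IsIso m := by
  constructor
  · intro H M m _ a b ha hb
    obtain ⟨d, hd, -, -⟩ := H.exists_lift m (𝟙 B) a b (by simpa) (by simpa)
    have : IsSplitEpi m := ⟨⟨d, hd⟩⟩
    exact isIso_of_mono_of_isSplitEpi m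
  · refine fun H => ⟨fun W s t hf hg => ?_, fun M N m _ v a b ha hb => ?_⟩
    · have := H (equalizer.ι s t) (equalizer.lift f hf) (equalizer.lift g hg)
        (equalizer.lift_ι _ _) (equalizer.lift_ι _ _)
      exact eq_of_epi_equalizer
    · have := H (pullback.fst v m) (pullback.lift f a ha.symm) (pullback.lift g b hb.symm)
        (pullback.lift_fst _ _ _) (pullback.lift_fst _ _ _)
      have hd : (inv (pullback.fst v m) ≫ pullback.snd v m) ≫ m = v := by
        rw [Category.assoc, ← pullback.condition, IsIso.inv_hom_id_assoc]
      refine ⟨_, hd, ?_, ?_⟩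
      · rw [← cancel_mono m, Category.assoc, hd, ha]
      · rw [← cancel_mono m, Category.assoc, hd, hb]

lemma jointlyStrongEpi_of_comp_left {W X Z B : C} {k : W ⟶ X} {f : X ⟶ B} {g : Z ⟶ B}
    (H : JointlyStrongEpi (k ≫ f) g) : JointlyStrongEpi f g where
  jointlyEpi _ s t hf hg := H.jointlyEpi s t (by simp only [Category.assoc, hf]) hg
  exists_lift M N m _ v a b ha hb := by
    obtain ⟨d, hd, -, hb'⟩ := H.exists_lift m v (k ≫ a) b (by simp only [Category.assoc, ha]) hb
    exact ⟨d, hd, by rw [← cancel_mono m, Category.assoc, hd, ha], hb'⟩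

lemma jointlyStrongEpi_comp_iso {X Z B B' : C} {f : X ⟶ B} {g : Z ⟶ B} (H : JointlyStrongEpi f g)
    (i : B ≅ B') : JointlyStrongEpi (f ≫ i.hom) (g ≫ i.hom) where
  jointlyEpi _ s t hf hg := by
    rw [← cancel_epi i.hom]
    exact H.jointlyEpi _ _ (by simpa using hf) (by simpa using hg)
  exists_lift M N m _ v a b ha hb := by
    obtain ⟨d, hd, ha', hb'⟩ :=
      H.exists_lift m (i.hom ≫ v) a b (by simpa using ha) (by simpa using hb)
    exact ⟨i.inv ≫ d, by simp [hd], by simpa, by simpa⟩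

variable [HasFiniteLimits C] {A B D : C}

lemma sndDiag_σ_fst (Y : C) : (Point.sndDiag Y).σ ≫ prod.fst = 𝟙 Y :=
  prod.lift_fst _ _

lemma baseChange_σ_fst (p : Point A B) (g : D ⟶ B) :
    (p.baseChange g).σ ≫ pullback.fst p.π g = g ≫ p.σ :=
  pullback.lift_fst _ _ _

variable [HasZeroMorphisms C] {Y : C}

lemma isStrong_of_isStablyStrong {p : Point A B} (H : p.IsStablyStrong) : p.IsStrong := by
  let q := p.baseChange (𝟙 B)
  let fst := pullback.fst p.π (𝟙 B)
  have hι : (kernel.ι q.π ≫ fst) ≫ p.π = 0 := by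
    have : fst ≫ p.π = q.π := pullback.condition.trans (Category.comp_id _)
    rw [Category.assoc, this, kernel.condition]
  have hσ : q.σ ≫ fst = p.σ := (baseChange_σ_fst p (𝟙 B)).trans (Category.id_comp _)
  have h := jointlyStrongEpi_comp_iso (H (𝟙 B)) (asIso fst)
  rw [asIso_hom, hσ, ← kernel.lift_ι p.π _ hι] at h
  exact jointlyStrongEpi_of_comp_left h

theorem isMaltsevObject_of_isProtomodularObject (H : IsProtomodularObject Y) :
    IsMaltsevObject Y := by
  intro A D p q
  have h : JointlyStrongEpi (kernel.ι (pullback.snd p.π q.π)) _ := H p q.π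
  have hι : (kernel.ι (pullback.snd p.π q.π) ≫ pullback.fst p.π q.π) ≫
      pullback.lift (𝟙 A) (p.π ≫ q.σ) (by simp [q.σ_π]) = kernel.ι (pullback.snd p.π q.π) := by
    ext <;> simp [pullback.condition_assoc]
  rw [← hι] at h
  exact jointlyStrongEpi_of_comp_left h

/-- Let `(p.π, r)` be a relation from a Mal'tsev object `Y` that relates every element of `Y` to
`0`. Whether it relates `y` to `d` does not depend on `y`: it contains the corners `(y', d)`,
`(y', 0)` and `(y, 0)` of a rectangle, hence the fourth one. -/
lemma exists_relation_lift_of_isMaltsevObject (H : IsMaltsevObject Y) (p : Point A Y) (r : A ⟶ D)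
    [Mono (prod.lift p.π r)] (hr : p.σ ≫ r = 0) {T : C} (x : T ⟶ A) (y : T ⟶ Y) :
    ∃ t : T ⟶ A, t ≫ p.π = y ∧ t ≫ r = x ≫ r := by
  let q := Point.sndDiag Y
  let corner : pullback p.π q.π ⟶ Y ⨯ D :=
    prod.lift (pullback.snd p.π q.π ≫ prod.fst) (pullback.fst p.π q.π ≫ r)
  obtain ⟨d, hd, -, -⟩ := (H p q).exists_lift (prod.lift p.π r) corner (𝟙 A) (prod.fst ≫ p.σ)
    (by ext <;> simp [corner, q, sndDiag_σ_fst]) (by ext <;> simp [corner, hr, p.σ_π])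
  have hd₁ : d ≫ p.π = pullback.snd p.π q.π ≫ prod.fst := by simpa [corner] using hd =≫ prod.fst
  have hd₂ : d ≫ r = pullback.fst p.π q.π ≫ r := by simpa [corner] using hd =≫ prod.snd
  have hq : x ≫ p.π = prod.lift y (x ≫ p.π) ≫ q.π := (prod.lift_snd _ _).symm
  let e : T ⟶ pullback p.π q.π := pullback.lift x (prod.lift y (x ≫ p.π)) hq
  exact ⟨e ≫ d, by simp [e, hd₁], by simp [e, hd₂]⟩

theorem isStronglyUnitalObject_of_isMaltsevObject (H : IsMaltsevObject Y) :
    IsStronglyUnitalObject Y := by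
  intro D g
  let q := (Point.sndDiag Y).baseChange g
  let u : pullback (Point.sndDiag Y).π g ⟶ Y := pullback.fst _ g ≫ prod.fst
  have hom_ext {T : C} {s t : T ⟶ pullback (Point.sndDiag Y).π g}
      (h₁ : s ≫ u = t ≫ u) (h₂ : s ≫ q.π = t ≫ q.π) : s = t := by
    have hu : pullback.fst _ g ≫ prod.snd = q.π ≫ g := pullback.condition
    refine pullback.hom_ext (prod.hom_ext (by simpa [u] using h₁) ?_) h₂
    simpa only [Category.assoc, hu] using h₂ =≫ g
  have hj : prod.lift (𝟙 Y) 0 ≫ (Point.sndDiag Y).π = 0 ≫ g := by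
    rw [zero_comp]; exact prod.lift_snd _ _
  let i : Y ⟶ kernel q.π :=
    kernel.lift q.π (pullback.lift (prod.lift (𝟙 Y) 0) 0 hj) (pullback.lift_snd _ _ _)
  have hi : i ≫ kernel.ι q.π ≫ u = 𝟙 Y := (kernel.lift_ι_assoc _ _ _ _).trans (by simp [u])
  refine jointlyStrongEpi_iff_isIso.2 fun M m _ a b (ha : a ≫ m = kernel.ι q.π) hb => ?_
  have : Mono (prod.lift (m ≫ u) (m ≫ q.π)) := ⟨fun s t h => (cancel_mono m).1 <|
    hom_ext (by simpa using h =≫ prod.fst) (by simpa using h =≫ prod.snd)⟩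
  let p : Point M Y := ⟨m ≫ u, i ≫ a, by rw [Category.assoc, reassoc_of% ha, hi]⟩
  have hp : p.σ ≫ m ≫ q.π = 0 := by simp [p, reassoc_of% ha]
  obtain ⟨t, ht₁, ht₂⟩ := exists_relation_lift_of_isMaltsevObject H p (m ≫ q.π) hp (q.π ≫ b) u
  have hb' : b ≫ m ≫ q.π = 𝟙 D := by rw [reassoc_of% hb, q.σ_π]
  have ht : t ≫ m = 𝟙 _ := hom_ext (by simpa [p] using ht₁) (by simpa [hb'] using ht₂)
  have : IsSplitEpi m := ⟨⟨t, ht⟩⟩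
  exact isIso_of_mono_of_isSplitEpi m

end Categorical

namespace ROrdGrp

variable {X Z E : ROrdGrp.{u}}

/-- The group homomorphism underlying a morphism of right-preordered groups. -/
def toAddMonoidHom (f : X ⟶ E) : X →+ E := (ConcreteCategory.hom f : X →+o E)

/-- The restriction of a morphism of right-preordered groups to the positive cones. -/
def coneMap (f : X ⟶ E) : X.positiveCone →+ E.positiveCone :=
  ((toAddMonoidHom f).comp X.positiveCone.subtype).codRestrict E.positiveCone
    fun x => map_nonneg (ConcreteCategory.hom f) x.2

/-- The right-preordered group with underlying group `G` and positive cone `S`. -/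
def ofCone {G : Type u} [AddGroup G] (S : AddSubmonoid G) : ROrdGrp.{u} :=
  letI : Preorder G :=
    { le x y := y - x ∈ S
      le_refl x := by simp
      le_trans x y z hxy hyz := by simpa using S.add_mem hyz hxy }
  haveI : AddRightMono G := ⟨fun z x y (h : y - x ∈ S) => by
    change y + z - (x + z) ∈ S
    rwa [add_sub_add_right_eq_sub]⟩
  of G

lemma nonneg_ofCone_iff {G : Type u} [AddGroup G] {S : AddSubmonoid G} {x : ofCone S} :
    0 ≤ x ↔ x ∈ S :=
  iff_of_eq (congrArg (· ∈ S) (sub_zero (G := G) x))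

/-- A group homomorphism that preserves positive elements, as a morphism of right-preordered
groups. -/
def homOfNonneg (f : X →+ E) (hf : ∀ x, 0 ≤ x → 0 ≤ f x) : X ⟶ E :=
  ofHom { f with
    monotone' := fun x y h => by
      have := hf _ (sub_nonneg.2 h)
      rwa [map_sub, sub_nonneg] at this }

lemma injective_of_mono (m : X ⟶ E) [Mono m] : Function.Injective m := by
  intro x y h
  have hm : (pullbackCone m m).fst = (pullbackCone m m).snd :=
    (cancel_mono m).1 (pullbackCone m m).condition
  exact ConcreteCategory.congr_hom hm (⟨(x, y), h⟩ : pullbackObj m m)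

lemma isIso_of_range_eq_top (m : X ⟶ E) [Mono m] (hm : (toAddMonoidHom m).range = ⊤)
    (hm' : AddMonoidHom.mrange (coneMap m) = ⊤) : IsIso m := by
  let φ : X ≃+ E := AddEquiv.ofBijective (toAddMonoidHom m)
    ⟨injective_of_mono m, AddMonoidHom.range_eq_top.1 hm⟩
  let n : E ⟶ X := homOfNonneg φ.symm fun e he => by
    obtain ⟨x, hx⟩ := AddMonoidHom.mrange_eq_top.1 hm' ⟨e, he⟩
    have hφ : φ.symm e = x := φ.symm_apply_eq.2 (congrArg Subtype.val hx).symm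
    exact hφ ▸ x.2
  exact ⟨n, hom_ext φ.symm_apply_apply, hom_ext φ.apply_symm_apply⟩

lemma sup_eq_top_of_jointlyStrongEpi {f : X ⟶ E} {g : Z ⟶ E} (H : JointlyStrongEpi f g) :
    (toAddMonoidHom f).range ⊔ (toAddMonoidHom g).range = ⊤ ∧
      AddMonoidHom.mrange (coneMap f) ⊔ AddMonoidHom.mrange (coneMap g) = ⊤ := by
  let G := (toAddMonoidHom f).range ⊔ (toAddMonoidHom g).range
  let P := AddMonoidHom.mrange (coneMap f) ⊔ AddMonoidHom.mrange (coneMap g)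
  let S : AddSubmonoid G := (P.map E.positiveCone.subtype).comap G.subtype
  let m : ofCone S ⟶ E := homOfNonneg (X := ofCone S) G.subtype fun x hx => by
    obtain ⟨e, -, he⟩ := nonneg_ofCone_iff.1 hx
    exact he ▸ e.2
  let a : X ⟶ ofCone S := homOfNonneg (E := ofCone S)
    ((toAddMonoidHom f).codRestrict G fun x => le_sup_left (α := AddSubgroup E) ⟨x, rfl⟩)
    fun x hx => nonneg_ofCone_iff.2
      ⟨coneMap f ⟨x, hx⟩, le_sup_left (α := AddSubmonoid E.positiveCone) ⟨_, rfl⟩, rfl⟩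
  let b : Z ⟶ ofCone S := homOfNonneg (E := ofCone S)
    ((toAddMonoidHom g).codRestrict G fun x => le_sup_right (α := AddSubgroup E) ⟨x, rfl⟩)
    fun x hx => nonneg_ofCone_iff.2
      ⟨coneMap g ⟨x, hx⟩, le_sup_right (α := AddSubmonoid E.positiveCone) ⟨_, rfl⟩, rfl⟩
  have : Mono m := ⟨fun s t h => hom_ext fun x =>
    Subtype.ext (ConcreteCategory.congr_hom h x)⟩
  have := jointlyStrongEpi_iff_isIso.1 H m a b rfl rfl
  have hinv (e : E) : m (inv m e) = e := ConcreteCategory.congr_hom (IsIso.inv_hom_id m) e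
  refine ⟨eq_top_iff.2 fun e _ => ?_, eq_top_iff.2 fun e _ => ?_⟩
  · rw [← hinv e]
    exact (inv m e).2
  · obtain ⟨e', he', h⟩ := nonneg_ofCone_iff.1 (map_nonneg (ConcreteCategory.hom (inv m)) e.2)
    rwa [Subtype.ext (h.trans (hinv e))] at he'

theorem jointlyStrongEpi_iff {f : X ⟶ E} {g : Z ⟶ E} : JointlyStrongEpi f g ↔
    (toAddMonoidHom f).range ⊔ (toAddMonoidHom g).range = ⊤ ∧
      AddMonoidHom.mrange (coneMap f) ⊔ AddMonoidHom.mrange (coneMap g) = ⊤ := by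
  refine ⟨sup_eq_top_of_jointlyStrongEpi, ?_⟩
  rintro ⟨hG, hP⟩
  rw [jointlyStrongEpi_iff_isIso]
  rintro M m _ a b rfl rfl
  refine isIso_of_range_eq_top m (top_unique (hG ▸ sup_le ?_ ?_))
    (top_unique (hP ▸ sup_le ?_ ?_))
  · rintro _ ⟨x, rfl⟩
    exact ⟨a x, rfl⟩
  · rintro _ ⟨z, rfl⟩
    exact ⟨b z, rfl⟩
  · rintro _ ⟨x, rfl⟩
    exact ⟨coneMap a x, rfl⟩
  · rintro _ ⟨z, rfl⟩
    exact ⟨coneMap b z, rfl⟩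

lemma exists_kernel_ι_eq (f : X ⟶ E) {x : X} (hx : f x = 0) :
    ∃ k : (kernel f : ROrdGrp.{u}), kernel.ι f k = x ∧ (0 ≤ x → 0 ≤ k) := by
  let c := pullbackCone f (0 : X ⟶ E)
  have hc : c.fst ≫ f = 0 := by rw [c.condition, comp_zero]
  let l := kernel.lift f c.fst hc
  let w : pullbackObj f (0 : X ⟶ E) := ⟨(x, 0), hx⟩
  exact ⟨l w, ConcreteCategory.congr_hom (kernel.lift_ι f c.fst hc) w,
    fun h => map_nonneg (ConcreteCategory.hom l) (a := w) ⟨h, le_refl (0 : X)⟩⟩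

lemma range_kernel_ι (f : X ⟶ E) :
    (toAddMonoidHom (kernel.ι f)).range = (toAddMonoidHom f).ker := by
  refine le_antisymm ?_ fun x hx => ?_
  · rintro _ ⟨k, rfl⟩
    exact ConcreteCategory.congr_hom (kernel.condition f) k
  · obtain ⟨k, hk, -⟩ := exists_kernel_ι_eq f hx
    exact ⟨k, hk⟩

lemma mrange_coneMap_kernel_ι (f : X ⟶ E) :
    AddMonoidHom.mrange (coneMap (kernel.ι f)) = AddMonoidHom.mker (coneMap f) := by
  refine le_antisymm ?_ fun x hx => ?_
  · rintro _ ⟨k, rfl⟩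
    exact Subtype.ext (ConcreteCategory.congr_hom (kernel.condition f) k.1)
  · obtain ⟨k, hk, hk'⟩ := exists_kernel_ι_eq f (congrArg Subtype.val hx)
    exact ⟨⟨k, hk' x.2⟩, Subtype.ext hk⟩

lemma pullback_nonneg_iff (f : X ⟶ E) (g : Z ⟶ E) {x : (pullback f g : ROrdGrp.{u})} :
    0 ≤ x ↔ 0 ≤ pullback.fst f g x ∧ 0 ≤ pullback.snd f g x := by
  refine ⟨fun hx => ⟨map_nonneg (ConcreteCategory.hom (pullback.fst f g)) hx,
    map_nonneg (ConcreteCategory.hom (pullback.snd f g)) hx⟩, fun hx => ?_⟩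
  let i : pullback f g ≅ pullbackObj f g :=
    (limit.isLimit (cospan f g)).conePointUniqueUpToIso (pullbackConeIsLimit f g)
  have hi : i.inv (i.hom x) = x := ConcreteCategory.congr_hom i.hom_inv_id x
  exact hi ▸ map_nonneg (ConcreteCategory.hom i.inv) (a := i.hom x) hx

variable {A B Y : ROrdGrp.{u}}

lemma isStrong_of_sub_nonneg {p : Point A B} (hp : ∀ a, 0 ≤ a → 0 ≤ a - p.σ (p.π a)) :
    p.IsStrong := by
  have hker (a : A) : p.π (a - p.σ (p.π a)) = 0 := by
    have hπσ : p.π (p.σ (p.π a)) = p.π a := ConcreteCategory.congr_hom p.σ_π (p.π a)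
    rw [map_sub, hπσ, sub_self]
  refine jointlyStrongEpi_iff.2 ⟨eq_top_iff.2 fun a _ => ?_, eq_top_iff.2 fun ⟨a, ha⟩ _ => ?_⟩
  · rw [← sub_add_cancel a (p.σ (p.π a)), range_kernel_ι]
    exact add_mem (le_sup_left (α := AddSubgroup A) (hker a))
      (le_sup_right (α := AddSubgroup A) ⟨p.π a, rfl⟩)
  · have hsum : (⟨a, ha⟩ : A.positiveCone) =
        ⟨a - p.σ (p.π a), hp a ha⟩ + coneMap p.σ (coneMap p.π ⟨a, ha⟩) :=
      Subtype.ext (sub_add_cancel a (p.σ (p.π a))).symm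
    rw [hsum, mrange_coneMap_kernel_ι]
    exact add_mem (le_sup_left (α := AddSubmonoid A.positiveCone) (Subtype.ext (hker a)))
      (le_sup_right (α := AddSubmonoid A.positiveCone) ⟨_, rfl⟩)

lemma isStablyStrong_of_sub_nonneg {p : Point A B} (hp : ∀ a, 0 ≤ a → 0 ≤ a - p.σ (p.π a)) :
    p.IsStablyStrong := by
  intro D g
  let q := p.baseChange g
  refine isStrong_of_sub_nonneg fun x hx => (pullback_nonneg_iff _ _).2 ⟨?_, ?_⟩
  · have hfst : pullback.fst p.π g (q.σ (q.π x)) = p.σ (p.π (pullback.fst p.π g x)) :=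
      (ConcreteCategory.congr_hom (baseChange_σ_fst p g) (q.π x)).trans
        (congrArg p.σ (ConcreteCategory.congr_hom pullback.condition x).symm)
    rw [map_sub, hfst]
    exact hp _ (map_nonneg (ConcreteCategory.hom (pullback.fst p.π g)) hx)
  · have hsnd : q.π (q.σ (q.π x)) = q.π x := ConcreteCategory.congr_hom q.σ_π (q.π x)
    exact ((map_sub (ConcreteCategory.hom q.π) _ _).trans (sub_eq_zero.2 hsnd.symm)).ge

lemma isAddUnit_positiveCone_iff {y : Y.positiveCone} : IsAddUnit y ↔ 0 ≤ -(y : Y) := by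
  rw [isAddUnit_iff_exists_neg]
  refine ⟨fun ⟨z, hz⟩ => ?_, fun hy => ⟨⟨-y, hy⟩, Subtype.ext (add_neg_cancel _)⟩⟩
  rw [neg_eq_of_add_eq_zero_right (congrArg Subtype.val hz)]
  exact z.2

theorem isProtomodularObject_of_forall_isAddUnit (hY : ∀ y : Y.positiveCone, IsAddUnit y) :
    IsProtomodularObject Y := by
  refine fun A p => isStablyStrong_of_sub_nonneg fun a ha => ?_
  have hπ : 0 ≤ -p.π a := isAddUnit_positiveCone_iff.1 (hY (coneMap p.π ⟨a, ha⟩))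
  rw [sub_eq_add_neg, ← map_neg]
  exact A.positiveCone.add_mem ha (map_nonneg (ConcreteCategory.hom p.σ) hπ)

theorem isAddUnit_of_isStronglyUnitalObject (H : IsStronglyUnitalObject Y) (y : Y.positiveCone) :
    IsAddUnit y := by
  let fst : Y ⨯ Y ⟶ Y := prod.fst
  let snd : Y ⨯ Y ⟶ Y := prod.snd
  have hσ : (Point.sndDiag Y).σ ≫ fst = (Point.sndDiag Y).σ ≫ snd :=
    (sndDiag_σ_fst Y).trans (Point.sndDiag Y).σ_π.symm
  let S : AddSubmonoid (Y ⨯ Y : ROrdGrp.{u}).positiveCone :=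
    { carrier := {e | IsAddUnit (coneMap fst e) → IsAddUnit (coneMap snd e)}
      zero_mem' := fun _ => by simp
      add_mem' := fun {d e} hd he h => by
        rw [map_add, IsAddUnit.add_iff] at h ⊢
        exact ⟨hd h.1, he h.2⟩ }
  have hS : S = ⊤ := by
    refine top_unique ((jointlyStrongEpi_iff.1 (isStrong_of_isStablyStrong H)).2 ▸ sup_le ?_ ?_)
    · rw [mrange_coneMap_kernel_ι]
      rintro e (he : coneMap snd e = 0) -
      exact he ▸ isAddUnit_zero
    · rintro _ ⟨z, rfl⟩ h
      change IsAddUnit (coneMap (_ ≫ snd) z)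
      rwa [← hσ]
  have hy : coneMap (prod.lift 0 (𝟙 Y)) y ∈ S := hS ▸ AddSubmonoid.mem_top _
  have hfst : coneMap fst (coneMap (prod.lift 0 (𝟙 Y)) y) = 0 :=
    Subtype.ext (ConcreteCategory.congr_hom (prod.lift_fst (0 : Y ⟶ Y) (𝟙 Y)) (y : Y))
  have hsnd : coneMap snd (coneMap (prod.lift 0 (𝟙 Y)) y) = y :=
    Subtype.ext (ConcreteCategory.congr_hom (prod.lift_snd (0 : Y ⟶ Y) (𝟙 Y)) (y : Y))
  exact hsnd ▸ hy (hfst ▸ isAddUnit_zero)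

lemma forall_isAddUnit_positiveCone_iff_equivalence_le :
    (∀ y : Y.positiveCone, IsAddUnit y) ↔ _root_.Equivalence (fun x y : Y => x ≤ y) := by
  simp only [isAddUnit_positiveCone_iff]
  refine ⟨fun h => ⟨le_refl, fun {x y} hxy => ?_, le_trans⟩, fun h y => ?_⟩
  · have := h ⟨y - x, sub_nonneg.2 hxy⟩
    rwa [neg_sub, sub_nonneg] at this
  · rw [← zero_sub, sub_nonneg]
    exact h.symm y.2

end ROrdGrp

theorem theorem3p4 (Y : ROrdGrp.{u}) :
    List.TFAE [
      IsProtomodularObject Y,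
      IsMaltsevObject Y,
      IsStronglyUnitalObject Y,
      ∀ x : Y.positiveCone, IsAddUnit x,
      _root_.Equivalence (fun x y : Y => x ≤ y)] := by
  tfae_have 1 → 2 := isMaltsevObject_of_isProtomodularObject
  tfae_have 2 → 3 := isStronglyUnitalObject_of_isMaltsevObject
  tfae_have 3 → 4 := ROrdGrp.isAddUnit_of_isStronglyUnitalObject
  tfae_have 4 → 1 := ROrdGrp.isProtomodularObject_of_forall_isAddUnit
  tfae_have 4 ↔ 5 := ROrdGrp.forall_isAddUnit_positiveCone_iff_equivalence_le
  tfae_finish
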